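/- Let $X$ be a real random variable whose characteristic function $f$ is symmetric, $f(-t)=f(t)$, and whose law is infinitely divisible (for each integer $n\ge 1$ it is the law of a sum of $n$ independent identically distributed random variables). For every integer $m\ge 1$ put $f_m(t)=f(\sqrt m\,t)^{1/m}$ (the positive $m$-th root; recall that such an $f$ takes values in $(0,1]$). All variances are understood in $[0,\infty]$, the variance being $\infty$ if the second moment is infinite; no moment assumption is made. Then: (i) For every integer $m\ge 1$, $f_m$ is a characteristic function, and every random variable $X_m$ with characteristic function $f_m$ satisfies $\mathrm{Var}(X_m)=\mathrm{Var}(X)$. (ii) The pointwise limit $g(t)=\lim_{m\to\infty} f_m(t)$ exists for all real $t$ and is a characteristic function. If the law of $X$ is not Gaussian (constants being counted as Gaussian with variance $0$), then $\mathrm{Var}(X)>\mathrm{Var}(Z)$ for every random variable $Z$ with characteristic function $g$; in particular $\mathrm{Var}(Z)<\infty$. -/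

import Mathlib

open MeasureTheory ProbabilityTheory Filter Topology

/-- A measure `μ` on `ℝ` is infinitely divisible if it is a probability measure and, for every
`n ≥ 1`, it is the law of the sum of `n` independent random variables with a common law `ν`
(here: the coordinates on `ℝⁿ` under the product measure `ν ⊗ ⋯ ⊗ ν`). -/
def IsInfinitelyDivisible (μ : Measure ℝ) : Prop :=
  IsProbabilityMeasure μ ∧
    ∀ n : ℕ, 1 ≤ n → ∃ ν : Measure ℝ, IsProbabilityMeasure ν ∧
      (Measure.pi (fun _ : Fin n => ν)).map (fun x => ∑ i, x i) = μ

/-- The function `f_m(t) = f(√m t) ^ (1 / m)`. The characteristic function of a symmetric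
infinitely divisible law has values in `(0, ∞)`, where the principal power used here is the
positive `m`-th root. -/
noncomputable def rescaledRoot (f : ℝ → ℂ) (m : ℕ) (t : ℝ) : ℂ :=
  f (Real.sqrt m * t) ^ (1 / (m : ℂ))

/-! Write `f = exp (-ψ)`. Every `|f| ^ (1/n)` is a characteristic function and `n (1 - |f| ^ (1/n))
→ ψ`, so `ψ` inherits the weighted inequality of `1 - cos`; optimizing the weight makes `√ψ`
subadditive. No Lévy–Khintchine formula is needed. By Fekete, `√ψ(s) / s` tends to its infimum over
`s > 0`; with `c` the square of that infimum, `ψ(√m t) / m → c t²` and `c t² ≤ ψ(t)`. Subadditivity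
also makes the variance at most `2c'` exactly when `ψ(t) ≤ c' t²` for all `t`
(`evariance_le_iff_exponent_le`), a condition unchanged by the rescaling. If `Var X ≤ 2c`, both
bounds meet and `X` is Gaussian. -/

/-! ### The weighted inequality for `1 - cos`. -/

section Trigonometry

lemma one_sub_cos_eq_two_mul_sin_sq (x : ℝ) : 1 - Real.cos x = 2 * Real.sin (x / 2) ^ 2 := by
  have h := Real.cos_sq_add_sin_sq (x / 2)
  have h2 := Real.cos_two_mul (x / 2)
  rw [mul_div_cancel₀ x two_ne_zero] at h2
  linarith

/-- Sine addition at half angles and `2xy ≤ l x² + l⁻¹ y²`. The weight stays free for a later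
optimization. -/
lemma one_sub_cos_add_le (a b : ℝ) {l : ℝ} (hl : 0 < l) :
    1 - Real.cos (a + b) ≤ (1 + l) * (1 - Real.cos a) + (1 + l⁻¹) * (1 - Real.cos b) := by
  simp only [one_sub_cos_eq_two_mul_sin_sq, add_div, Real.sin_add]
  set u := Real.sin (a / 2)
  set v := Real.sin (b / 2)
  set c := Real.cos (a / 2)
  set d := Real.cos (b / 2)
  have hc1 : c ^ 2 ≤ 1 := Real.cos_sq_le_one _
  have hd1 : d ^ 2 ≤ 1 := Real.cos_sq_le_one _
  have hli : 0 < l⁻¹ := inv_pos.2 hl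
  have key : (u * d + c * v) ^ 2 ≤ (1 + l) * (u * d) ^ 2 + (1 + l⁻¹) * (c * v) ^ 2 := by
    have : 0 ≤ l⁻¹ * (l * (u * d) - c * v) ^ 2 := by positivity
    have e : l⁻¹ * (l * (u * d) - c * v) ^ 2
        = l * (u * d) ^ 2 - 2 * (u * d) * (c * v) + l⁻¹ * (c * v) ^ 2 := by
      field_simp
      ring
    nlinarith
  have h1 : (1 + l) * (u * d) ^ 2 ≤ (1 + l) * u ^ 2 := by
    rw [mul_pow]
    exact mul_le_mul_of_nonneg_left (mul_le_of_le_one_right (sq_nonneg u) hd1) (by linarith)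
  have h2 : (1 + l⁻¹) * (c * v) ^ 2 ≤ (1 + l⁻¹) * v ^ 2 := by
    rw [mul_pow]
    exact mul_le_mul_of_nonneg_left (mul_le_of_le_one_left (sq_nonneg v) hc1) (by linarith)
  linarith

end Trigonometry

/-! ### Transfer to characteristic functions by integration. -/

section RealCharFun

variable {ρ : Measure ℝ} [IsProbabilityMeasure ρ]

lemma integrable_cos_mul (t : ℝ) : Integrable (fun x => Real.cos (t * x)) ρ := by
  refine Integrable.of_bound (C := 1) (by fun_prop) (ae_of_all _ fun x => ?_)
  simpa using Real.abs_cos_le_one (t * x)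

lemma integral_cos_mul_eq_re_charFun (t : ℝ) :
    ∫ x, Real.cos (t * x) ∂ρ = (charFun ρ t).re := by
  have hint : Integrable (fun x : ℝ => Complex.exp (t * x * Complex.I)) ρ := by
    refine Integrable.of_bound (C := 1) (by fun_prop) (ae_of_all _ fun x => ?_)
    rw [← Complex.ofReal_mul, Complex.norm_exp_ofReal_mul_I]
  rw [charFun_apply_real]
  have := integral_re hint
  simp only [RCLike.re_eq_complex_re] at this
  rw [← this]
  refine integral_congr_ae (ae_of_all _ fun x => ?_)
  simp only
  rw [← Complex.ofReal_mul, Complex.exp_ofReal_mul_I_re]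

lemma integral_one_sub_cos_mul (t : ℝ) :
    ∫ x, (1 - Real.cos (t * x)) ∂ρ = 1 - (charFun ρ t).re := by
  rw [integral_sub (integrable_const _) (integrable_cos_mul t), integral_cos_mul_eq_re_charFun]
  simp

lemma one_sub_re_charFun_add_le (s t : ℝ) {l : ℝ} (hl : 0 < l) :
    1 - (charFun ρ (s + t)).re ≤
      (1 + l) * (1 - (charFun ρ s).re) + (1 + l⁻¹) * (1 - (charFun ρ t).re) := by
  have hi : ∀ u : ℝ, Integrable (fun x => 1 - Real.cos (u * x)) ρ := fun u =>
    (integrable_const _).sub (integrable_cos_mul u)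
  simp only [← integral_one_sub_cos_mul, ← integral_const_mul]
  rw [← integral_add ((hi s).const_mul _) ((hi t).const_mul _)]
  refine integral_mono (hi _) (((hi s).const_mul _).add ((hi t).const_mul _)) fun x => ?_
  simpa only [add_mul] using one_sub_cos_add_le (s * x) (t * x) hl

end RealCharFun

/-! ### Roots of `|f|` and the exponent `ψ`. -/

section InfinitelyDivisible

/-- The symmetrization of a probability measure has characteristic function `|φ|²`. -/
lemma exists_charFun_eq_norm_sq (ν : Measure ℝ) [IsProbabilityMeasure ν] :
    ∃ ρ : Measure ℝ, IsProbabilityMeasure ρ ∧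
      ∀ t, charFun ρ t = ((‖charFun ν t‖ ^ 2 : ℝ) : ℂ) := by
  have : IsProbabilityMeasure (ν.map (fun x => (-1) * x)) :=
    Measure.isProbabilityMeasure_map (by fun_prop)
  refine ⟨ν ∗ ν.map (fun x => (-1) * x), inferInstance, fun t => ?_⟩
  rw [charFun_conv, charFun_map_mul, neg_one_mul, charFun_neg, Complex.mul_conj,
    Complex.normSq_eq_norm_sq]

variable {μ : Measure ℝ}

lemma IsInfinitelyDivisible.exists_charFun_eq_rpow (hμ : IsInfinitelyDivisible μ) {n : ℕ}
    (hn : 1 ≤ n) :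
    ∃ ρ : Measure ℝ, IsProbabilityMeasure ρ ∧
      ∀ t, charFun ρ t = ((‖charFun μ t‖ ^ (n : ℝ)⁻¹ : ℝ) : ℂ) := by
  -- Symmetrizing a `2n`-th root gives an `n`-th root of `|f|`.
  obtain ⟨ν, hν, hνμ⟩ := hμ.2 (2 * n) (by omega)
  obtain ⟨ρ, hρ, h⟩ := exists_charFun_eq_norm_sq ν
  refine ⟨ρ, hρ, fun t => ?_⟩
  have hf : charFun μ t = charFun ν t ^ (2 * n) := by
    rw [← hνμ, charFun_map_sum_pi_eq_prod]
    simp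
  rw [h t, hf, norm_pow, pow_mul, Real.pow_rpow_inv_natCast (by positivity) (by omega)]

/-- If `f(2s) = 0 ≠ f(s)`, weight `1` gives `1 ≤ 4 (1 - |f(s)| ^ (1/n)) → 0`. So a zero at `t`
passes to all `t / 2 ^ n`, against `f(0) = 1`. -/
lemma IsInfinitelyDivisible.charFun_ne_zero (hμ : IsInfinitelyDivisible μ) (t : ℝ) :
    charFun μ t ≠ 0 := by
  have := hμ.1
  have hdouble : ∀ s, charFun μ (s + s) = 0 → charFun μ s = 0 := by
    intro s hs
    by_contra hne
    have hlim : Tendsto (fun n : ℕ => ‖charFun μ s‖ ^ (n : ℝ)⁻¹) atTop (𝓝 1) := by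
      have h : Tendsto (fun x : ℝ => ‖charFun μ s‖ ^ x) (𝓝 0) (𝓝 (‖charFun μ s‖ ^ (0 : ℝ))) :=
        (Real.continuousAt_const_rpow (norm_ne_zero_iff.2 hne)).tendsto
      rw [Real.rpow_zero] at h
      exact h.comp tendsto_inv_atTop_nhds_zero_nat
    have hbound : ∀ᶠ n : ℕ in atTop, (1 : ℝ) ≤ 4 * (1 - ‖charFun μ s‖ ^ (n : ℝ)⁻¹) := by
      filter_upwards [eventually_ge_atTop 1] with n hn
      obtain ⟨ρ, hρ, h⟩ := hμ.exists_charFun_eq_rpow hn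
      have := one_sub_re_charFun_add_le (ρ := ρ) s s one_pos
      rw [h, h, hs, norm_zero, Real.zero_rpow (by positivity)] at this
      norm_num at this
      linarith
    have h1 := ge_of_tendsto ((hlim.const_sub 1).const_mul 4) hbound
    norm_num at h1
  intro ht
  have hz : ∀ n : ℕ, charFun μ (t / 2 ^ n) = 0 := by
    intro n
    induction n with
    | zero => simpa using ht
    | succ k ih =>
      apply hdouble
      rw [← ih]
      congr 1
      rw [pow_succ]
      field_simp
      norm_num
  have h0 : Tendsto (fun n : ℕ => charFun μ (t / 2 ^ n)) atTop (𝓝 (charFun μ 0)) :=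
    (continuous_charFun.tendsto 0).comp
      (tendsto_const_nhds.div_atTop (tendsto_pow_atTop_atTop_of_one_lt one_lt_two))
  simp only [hz, charFun_zero, probReal_univ] at h0
  simpa using tendsto_nhds_unique h0 tendsto_const_nhds

lemma IsInfinitelyDivisible.charFun_eq_norm (hμ : IsInfinitelyDivisible μ)
    (hsymm : ∀ t, charFun μ (-t) = charFun μ t) (t : ℝ) :
    charFun μ t = ((‖charFun μ t‖ : ℝ) : ℂ) := by
  have := hμ.1
  have hre : ∀ s, charFun μ s = ((charFun μ s).re : ℂ) := fun s =>
    (Complex.conj_eq_iff_re.1 ((charFun_neg s).symm.trans (hsymm s))).symm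
  have hcont : Continuous fun s => (charFun μ s).re :=
    Complex.continuous_re.comp continuous_charFun
  have hpos : 0 < (charFun μ t).re := by
    by_contra! hneg
    obtain ⟨s, hs⟩ := mem_range_of_exists_le_of_exists_ge hcont ⟨t, hneg⟩
      (⟨0, by simp⟩ : ∃ b, 0 ≤ (charFun μ b).re)
    refine hμ.charFun_ne_zero s ?_
    rw [hre s]
    simpa using hs
  rw [hre t, Complex.norm_real, Real.norm_of_nonneg hpos.le]

/-- The exponent `ψ` of `|f| = exp (-ψ)`. -/
noncomputable def negLogNormCharFun (μ : Measure ℝ) (t : ℝ) : ℝ := -Real.log ‖charFun μ t‖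

lemma negLogNormCharFun_neg (μ : Measure ℝ) (t : ℝ) :
    negLogNormCharFun μ (-t) = negLogNormCharFun μ t := by
  simp [negLogNormCharFun, charFun_neg]

lemma negLogNormCharFun_nonneg (μ : Measure ℝ) [IsProbabilityMeasure μ] (t : ℝ) :
    0 ≤ negLogNormCharFun μ t :=
  neg_nonneg.2 (Real.log_nonpos (norm_nonneg _) (norm_charFun_le_one t))

lemma IsInfinitelyDivisible.exp_neg_negLogNormCharFun (hμ : IsInfinitelyDivisible μ) (t : ℝ) :
    Real.exp (-negLogNormCharFun μ t) = ‖charFun μ t‖ := by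
  rw [negLogNormCharFun, neg_neg, Real.exp_log (norm_pos_iff.2 (hμ.charFun_ne_zero t))]

lemma IsInfinitelyDivisible.continuous_negLogNormCharFun (hμ : IsInfinitelyDivisible μ) :
    Continuous (negLogNormCharFun μ) := by
  have := hμ.1
  exact (continuous_charFun.norm.log fun t => norm_ne_zero_iff.2 (hμ.charFun_ne_zero t)).neg

lemma IsInfinitelyDivisible.negLogNormCharFun_add_le (hμ : IsInfinitelyDivisible μ) (s t : ℝ)
    {l : ℝ} (hl : 0 < l) :
    negLogNormCharFun μ (s + t) ≤
      (1 + l) * negLogNormCharFun μ s + (1 + l⁻¹) * negLogNormCharFun μ t := by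
  have hlim : ∀ u, Tendsto (fun n : ℕ => n * (1 - ‖charFun μ u‖ ^ (n : ℝ)⁻¹)) atTop
      (𝓝 (negLogNormCharFun μ u)) := by
    intro u
    have h := (tendsto_rpow_sub_one_log (norm_pos_iff.2 (hμ.charFun_ne_zero u))).comp
      ((tendsto_inv_atTop_nhdsGT_zero (𝕜 := ℝ)).comp tendsto_natCast_atTop_atTop)
    refine h.neg.congr fun n => ?_
    simp
    ring
  refine le_of_tendsto_of_tendsto (hlim (s + t))
    (((hlim s).const_mul _).add ((hlim t).const_mul _)) ?_
  filter_upwards [eventually_ge_atTop 1] with n hn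
  obtain ⟨ρ, hρ, h⟩ := hμ.exists_charFun_eq_rpow hn
  have key := one_sub_re_charFun_add_le (ρ := ρ) s t hl
  simp only [h, Complex.ofReal_re] at key
  have := mul_le_mul_of_nonneg_left key (Nat.cast_nonneg (α := ℝ) n)
  linarith

end InfinitelyDivisible

/-! ### Subadditivity of `√ψ` and linear growth. -/

section Subadditive

lemma sqrt_add_le_of_forall_pos {a b c : ℝ} (ha : 0 ≤ a) (hb : 0 ≤ b)
    (h : ∀ l : ℝ, 0 < l → c ≤ (1 + l) * a + (1 + l⁻¹) * b) : √c ≤ √a + √b := by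
  obtain ⟨x, hx⟩ : ∃ x, x = √a := ⟨_, rfl⟩
  obtain ⟨y, hy⟩ : ∃ y, y = √b := ⟨_, rfl⟩
  have hx0 : 0 ≤ x := hx ▸ Real.sqrt_nonneg a
  have hy0 : 0 ≤ y := hy ▸ Real.sqrt_nonneg b
  have hxa : a = x ^ 2 := by rw [hx, Real.sq_sqrt ha]
  have hyb : b = y ^ 2 := by rw [hy, Real.sq_sqrt hb]
  rw [← hx, ← hy]
  refine Real.sqrt_le_iff.2 ⟨by positivity, ?_⟩
  have hε : ∀ ε : ℝ, 0 < ε → c ≤ (x + y + 2 * ε) * (x + y) := by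
    intro ε hε
    -- The optimal weight is `y / x`; `ε` keeps it defined and positive.
    have h1 := h ((y + ε) / (x + ε)) (by positivity)
    have e1 : (1 + (y + ε) / (x + ε)) * a ≤ (x + y + 2 * ε) * x := by
      rw [hxa, one_add_div (by positivity), div_mul_eq_mul_div, div_le_iff₀ (by positivity)]
      have : 0 ≤ (x + y + 2 * ε) * x * ε := by positivity
      nlinarith
    have e2 : (1 + ((y + ε) / (x + ε))⁻¹) * b ≤ (x + y + 2 * ε) * y := by
      rw [hyb, inv_div, one_add_div (by positivity), div_mul_eq_mul_div,
        div_le_iff₀ (by positivity)]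
      have : 0 ≤ (x + y + 2 * ε) * y * ε := by positivity
      nlinarith
    linarith
  have hlim : Tendsto (fun ε : ℝ => (x + y + 2 * ε) * (x + y)) (𝓝[>] 0)
      (𝓝 ((x + y + 2 * 0) * (x + y))) :=
    ((by fun_prop : Continuous fun ε : ℝ => (x + y + 2 * ε) * (x + y)).tendsto 0).mono_left
      nhdsWithin_le_nhds
  have := ge_of_tendsto hlim (eventually_nhdsWithin_of_forall hε)
  linarith

lemma le_nat_mul_of_subadditive {p : ℝ → ℝ} (hp0 : p 0 = 0)
    (hp : ∀ s t, p (s + t) ≤ p s + p t) (n : ℕ) (t : ℝ) : p (n * t) ≤ n * p t := by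
  induction n with
  | zero => simp [hp0]
  | succ k ih =>
    have := hp (k * t) t
    push_cast
    rw [add_mul, one_mul]
    linarith

/-- Fekete's lemma on the half-line, for continuous functions. -/
lemma exists_tendsto_div_of_subadditive {p : ℝ → ℝ} (hcont : Continuous p) (hnn : ∀ t, 0 ≤ p t)
    (hp0 : p 0 = 0) (hp : ∀ s t, p (s + t) ≤ p s + p t) :
    ∃ l : ℝ, 0 ≤ l ∧ Tendsto (fun s => p s / s) atTop (𝓝 l) ∧ ∀ s, 0 < s → l * s ≤ p s := by
  set S : Set ℝ := (fun s => p s / s) '' Set.Ioi 0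
  have hbdd : BddBelow S := ⟨0, by
    rintro _ ⟨s, hs, rfl⟩
    exact div_nonneg (hnn s) (le_of_lt hs)⟩
  have hne : S.Nonempty := ⟨_, 1, Set.mem_Ioi.2 one_pos, rfl⟩
  have hle : ∀ s, 0 < s → sInf S ≤ p s / s := fun s hs => csInf_le hbdd ⟨s, hs, rfl⟩
  refine ⟨sInf S, le_csInf hne ?_, ?_, fun s hs => (le_div_iff₀ hs).1 (hle s hs)⟩
  · rintro _ ⟨s, hs, rfl⟩
    exact div_nonneg (hnn s) (le_of_lt hs)
  refine tendsto_order.2 ⟨fun a ha => ?_, fun a ha => ?_⟩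
  · filter_upwards [eventually_gt_atTop 0] with s hs using ha.trans_le (hle s hs)
  obtain ⟨_, ⟨s₀, hs₀, rfl⟩, hlt⟩ := exists_lt_of_csInf_lt hne ha
  have hs₀ : 0 < s₀ := hs₀
  obtain ⟨M, hM⟩ := (isCompact_Icc (a := (0 : ℝ)) (b := s₀)).bddAbove_image hcont.continuousOn
  -- Division with remainder: `s = k s₀ + r` with `r ∈ [0, s₀]`, where `p` is at most `M`.
  have hbound : ∀ s, 0 < s → p s / s ≤ p s₀ / s₀ + M / s := by
    intro s hs
    have hk0 := Nat.floor_le (div_nonneg hs.le hs₀.le)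
    have hk1 := Nat.lt_floor_add_one (s / s₀)
    rw [le_div_iff₀ hs₀] at hk0
    rw [div_lt_iff₀ hs₀] at hk1
    set k := ⌊s / s₀⌋₊
    have h1 : p s ≤ k * p s₀ + p (s - k * s₀) := by
      have := hp (k * s₀) (s - k * s₀)
      rw [add_sub_cancel] at this
      exact this.trans (add_le_add_left (le_nat_mul_of_subadditive hp0 hp k s₀) _)
    have h2 : p (s - k * s₀) ≤ M := hM ⟨_, ⟨by linarith, by linarith⟩, rfl⟩
    have h3 : k * p s₀ ≤ s / s₀ * p s₀ :=
      mul_le_mul_of_nonneg_right (Nat.floor_le (by positivity)) (hnn _)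
    rw [div_le_iff₀ hs]
    have e : (p s₀ / s₀ + M / s) * s = s / s₀ * p s₀ + M := by field_simp
    linarith
  have hlim : Tendsto (fun s : ℝ => p s₀ / s₀ + M / s) atTop (𝓝 (p s₀ / s₀ + 0)) :=
    tendsto_const_nhds.add (tendsto_const_nhds.div_atTop tendsto_id)
  rw [add_zero] at hlim
  filter_upwards [hlim.eventually_lt_const hlt, eventually_gt_atTop 0] with s h1 h2
  exact (hbound s h2).trans_lt h1

end Subadditive

/-! ### Variance read off from the exponent. -/

section Variance

lemma integral_eq_zero_of_charFun_neg {ρ : Measure ℝ} [IsProbabilityMeasure ρ]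
    (h : ∀ t, charFun ρ (-t) = charFun ρ t) : ∫ x, x ∂ρ = 0 := by
  have : IsProbabilityMeasure (ρ.map (fun x => (-1) * x)) :=
    Measure.isProbabilityMeasure_map (by fun_prop)
  have hρ : ρ.map (fun x => (-1) * x) = ρ := by
    refine Measure.ext_of_charFun (funext fun t => ?_)
    rw [charFun_map_mul, neg_one_mul, h]
  have h2 : ∫ x, x ∂ρ = ∫ x, (-1) * x ∂ρ := by
    conv_lhs => rw [← hρ]
    exact integral_map (by fun_prop) (by fun_prop)
  simp only [neg_one_mul] at h2
  rw [integral_neg] at h2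
  linarith

/-- The mean is `0` by symmetry, or by the default value of the integral if `Y` is not integrable,
so no moment is assumed. -/
lemma evariance_eq_lintegral_map_sq {Ω : Type*} [MeasurableSpace Ω] {P : Measure Ω}
    [IsProbabilityMeasure P] {Y : Ω → ℝ} (hY : AEMeasurable Y P)
    (h : ∀ t, charFun (P.map Y) (-t) = charFun (P.map Y) t) :
    evariance Y P = ∫⁻ x, ENNReal.ofReal (x ^ 2) ∂(P.map Y) := by
  have := Measure.isProbabilityMeasure_map hY
  have h0 : ∫ ω, Y ω ∂P = 0 := by
    rw [← integral_eq_zero_of_charFun_neg h]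
    exact (integral_map hY aestronglyMeasurable_id).symm
  rw [evariance_eq_lintegral_ofReal, lintegral_map' (by fun_prop) hY]
  simp [h0]

lemma tendsto_two_mul_sq_mul_one_sub_cos (x : ℝ) :
    Tendsto (fun n : ℕ => 2 * (n : ℝ) ^ 2 * (1 - Real.cos ((n : ℝ)⁻¹ * x))) atTop
      (𝓝 (x ^ 2)) := by
  have h0 : Tendsto (fun n : ℕ => Real.sinc ((n : ℝ)⁻¹ * x / 2)) atTop
      (𝓝 (Real.sinc (0 * x / 2))) :=
    (Real.continuous_sinc.tendsto _).comp
      ((tendsto_inv_atTop_nhds_zero_nat.mul_const x).div_const 2)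
  have h1 := (h0.pow 2).const_mul (x ^ 2)
  simp only [zero_mul, zero_div, Real.sinc_zero, one_pow, mul_one] at h1
  refine h1.congr' ?_
  filter_upwards [eventually_ge_atTop 1] with n hn
  have hn0 : (n : ℝ) ≠ 0 := by positivity
  rw [one_sub_cos_eq_two_mul_sin_sq]
  rcases eq_or_ne x 0 with rfl | hx
  · simp
  rw [Real.sinc_of_ne_zero (by positivity)]
  field_simp

variable {ρ : Measure ℝ} [IsProbabilityMeasure ρ] {ψ : ℝ → ℝ}

/-- Fatou for `2n² (1 - cos (x/n)) → x²`, whose integrals are at most `2n² ψ(1/n) ≤ 2c`. -/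
lemma lintegral_sq_le_of_exponent_le (hρ : ∀ t, charFun ρ t = ((Real.exp (-ψ t) : ℝ) : ℂ))
    {c : ℝ} (h : ∀ t, ψ t ≤ c * t ^ 2) :
    ∫⁻ x, ENNReal.ofReal (x ^ 2) ∂ρ ≤ ENNReal.ofReal (2 * c) := by
  let F : ℕ → ℝ → ENNReal := fun n x =>
    ENNReal.ofReal (2 * (n : ℝ) ^ 2 * (1 - Real.cos ((n : ℝ)⁻¹ * x)))
  have hF : ∀ n : ℕ, 1 ≤ n → ∫⁻ x, F n x ∂ρ ≤ ENNReal.ofReal (2 * c) := by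
    intro n hn
    rw [← ofReal_integral_eq_lintegral_ofReal, integral_const_mul, integral_one_sub_cos_mul, hρ,
      Complex.ofReal_re]
    · apply ENNReal.ofReal_le_ofReal
      have h1 := Real.add_one_le_exp (-ψ (n : ℝ)⁻¹)
      have h2 : 1 - Real.exp (-ψ (n : ℝ)⁻¹) ≤ c * (n : ℝ)⁻¹ ^ 2 := by linarith [h (n : ℝ)⁻¹]
      have hn0 : (n : ℝ) ≠ 0 := by positivity
      calc _ ≤ 2 * (n : ℝ) ^ 2 * (c * (n : ℝ)⁻¹ ^ 2) :=
            mul_le_mul_of_nonneg_left h2 (by positivity)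
        _ = 2 * c := by field_simp
    · exact ((integrable_const _).sub (integrable_cos_mul _)).const_mul _
    · exact ae_of_all _ fun x =>
        mul_nonneg (by positivity) (by linarith [Real.cos_le_one ((n : ℝ)⁻¹ * x)])
  have hlim : ∀ x, liminf (fun n => F n x) atTop = ENNReal.ofReal (x ^ 2) := fun x =>
    (ENNReal.tendsto_ofReal (tendsto_two_mul_sq_mul_one_sub_cos x)).liminf_eq
  calc _ = ∫⁻ x, liminf (fun n => F n x) atTop ∂ρ := by simp only [hlim]
    _ ≤ liminf (fun n => ∫⁻ x, F n x ∂ρ) atTop :=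
        lintegral_liminf_le fun n => by fun_prop
    _ ≤ ENNReal.ofReal (2 * c) :=
        liminf_le_of_frequently_le' (Eventually.frequently
          ((eventually_ge_atTop 1).mono fun n hn => hF n hn))

/-- `1 - cos y ≤ y²/2` gives a bound on `ψ` that is sharp only near `0`; `ψ(t) ≤ n² ψ(t/n)` carries
it to every `t`. -/
lemma exponent_le_of_lintegral_sq_le (hρ : ∀ t, charFun ρ t = ((Real.exp (-ψ t) : ℝ) : ℂ))
    (hψ : ∀ (n : ℕ) t, ψ (n * t) ≤ n ^ 2 * ψ t) {c : ℝ} (hc : 0 ≤ c)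
    (h : ∫⁻ x, ENNReal.ofReal (x ^ 2) ∂ρ ≤ ENNReal.ofReal (2 * c)) (t : ℝ) :
    ψ t ≤ c * t ^ 2 := by
  have hint : Integrable (fun x : ℝ => x ^ 2) ρ :=
    (lintegral_ofReal_ne_top_iff_integrable (by fun_prop)
      (ae_of_all _ fun x => sq_nonneg x)).1 (h.trans_lt ENNReal.ofReal_lt_top).ne
  have hval : ∫ x, x ^ 2 ∂ρ ≤ 2 * c := by
    rw [← ofReal_integral_eq_lintegral_ofReal hint (ae_of_all _ fun x => sq_nonneg x)] at h
    exact (ENNReal.ofReal_le_ofReal_iff (by positivity)).1 h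
  have hquad : ∀ s, 1 - c * s ^ 2 ≤ Real.exp (-ψ s) := by
    intro s
    have h1 : ∫ x, (1 - Real.cos (s * x)) ∂ρ ≤ ∫ x, s ^ 2 / 2 * x ^ 2 ∂ρ := by
      refine integral_mono ((integrable_const _).sub (integrable_cos_mul _))
        (hint.const_mul _) fun x => ?_
      have := Real.one_sub_sq_div_two_le_cos (x := s * x)
      simp only
      nlinarith
    rw [integral_one_sub_cos_mul, integral_const_mul, hρ, Complex.ofReal_re] at h1
    have := mul_le_mul_of_nonneg_left hval (by positivity : 0 ≤ s ^ 2 / 2)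
    linarith
  have hu : Tendsto (fun n : ℕ => c * t ^ 2 / (n : ℝ) ^ 2) atTop (𝓝 0) :=
    tendsto_const_nhds.div_atTop ((tendsto_pow_atTop two_ne_zero).comp tendsto_natCast_atTop_atTop)
  have hlim : Tendsto (fun n : ℕ => c * t ^ 2 / (1 - c * t ^ 2 / (n : ℝ) ^ 2)) atTop
      (𝓝 (c * t ^ 2 / (1 - 0))) :=
    tendsto_const_nhds.div (tendsto_const_nhds.sub hu) (by norm_num)
  rw [sub_zero, div_one] at hlim
  refine ge_of_tendsto hlim ?_
  filter_upwards [hu.eventually_lt_const one_pos, eventually_ge_atTop 1] with n hn1 hn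
  have hn0 : (n : ℝ) ≠ 0 := by positivity
  have h1 := hquad (t / n)
  rw [div_pow, ← mul_div_assoc] at h1
  set u := c * t ^ 2 / (n : ℝ) ^ 2 with hudef
  have hpos : 0 < 1 - u := by linarith
  have h2 := Real.log_le_log hpos h1
  rw [Real.log_exp] at h2
  have h3 := Real.one_sub_inv_le_log_of_pos hpos
  have h4 : ψ (t / n) ≤ u / (1 - u) := by
    have : u / (1 - u) = (1 - u)⁻¹ - 1 := by field_simp; ring
    linarith
  have h5 := hψ n (t / n)
  rw [mul_div_cancel₀ t hn0] at h5
  calc ψ t ≤ n ^ 2 * ψ (t / n) := h5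
    _ ≤ n ^ 2 * (u / (1 - u)) := mul_le_mul_of_nonneg_left h4 (by positivity)
    _ = c * t ^ 2 / (1 - u) := by rw [← mul_div_assoc, hudef, mul_div_cancel₀ _ (by positivity)]

/-- If the characteristic function of `Y` is `exp (-ψ)`, the variance of `Y` is the least
constant `2 c` with `ψ t ≤ c * t ^ 2`. -/
lemma evariance_le_iff_exponent_le {Ω : Type*} [MeasurableSpace Ω] {P : Measure Ω}
    [IsProbabilityMeasure P] {Y : Ω → ℝ} (hY : AEMeasurable Y P)
    (hρ : ∀ t, charFun (P.map Y) t = ((Real.exp (-ψ t) : ℝ) : ℂ))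
    (hψ : ∀ (n : ℕ) t, ψ (n * t) ≤ n ^ 2 * ψ t) {c : ℝ} (hc : 0 ≤ c) :
    evariance Y P ≤ ENNReal.ofReal (2 * c) ↔ ∀ t, ψ t ≤ c * t ^ 2 := by
  have := Measure.isProbabilityMeasure_map hY
  rw [evariance_eq_lintegral_map_sq hY fun t => by rw [charFun_neg, hρ, Complex.conj_ofReal]]
  exact ⟨exponent_le_of_lintegral_sq_le hρ hψ hc, lintegral_sq_le_of_exponent_le hρ⟩

end Variance

/-! ### The rescaled roots and the Gaussian part. -/

section RescaledRoot

lemma ENNReal.eq_of_forall_le_ofReal_two_mul_iff {a b : ENNReal}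
    (h : ∀ c : ℝ, 0 ≤ c → (a ≤ ENNReal.ofReal (2 * c) ↔ b ≤ ENNReal.ofReal (2 * c))) :
    a = b := by
  have key : ∀ {a b : ENNReal},
      (∀ c : ℝ, 0 ≤ c → (a ≤ ENNReal.ofReal (2 * c) → b ≤ ENNReal.ofReal (2 * c))) → b ≤ a := by
    intro a b h
    rcases eq_or_ne a ⊤ with rfl | ha
    · exact le_top
    have e : ENNReal.ofReal (2 * (a.toReal / 2)) = a := by
      rw [mul_div_cancel₀ _ two_ne_zero, ENNReal.ofReal_toReal ha]
    have := h (a.toReal / 2) (by positivity)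
    rw [e] at this
    exact this le_rfl
  exact le_antisymm (key fun c hc => (h c hc).2) (key fun c hc => (h c hc).1)

variable {μ : Measure ℝ}

lemma IsInfinitelyDivisible.rescaledRoot_charFun (hμ : IsInfinitelyDivisible μ)
    (hsymm : ∀ t, charFun μ (-t) = charFun μ t) (m : ℕ) (t : ℝ) :
    rescaledRoot (charFun μ) m t
      = ((Real.exp (-(negLogNormCharFun μ (√m * t) / m)) : ℝ) : ℂ) := by
  rw [rescaledRoot, hμ.charFun_eq_norm hsymm, ← hμ.exp_neg_negLogNormCharFun]
  have : (1 / (m : ℂ)) = ((1 / (m : ℝ) : ℝ) : ℂ) := by push_cast; rfl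
  rw [this, ← Complex.ofReal_cpow (Real.exp_pos _).le, ← Real.exp_mul]
  congr 2
  ring

lemma IsInfinitelyDivisible.exists_charFun_eq_rescaledRoot (hμ : IsInfinitelyDivisible μ)
    (hsymm : ∀ t, charFun μ (-t) = charFun μ t) {m : ℕ} (hm : 1 ≤ m) :
    ∃ ρ : Measure ℝ, IsProbabilityMeasure ρ ∧ charFun ρ = rescaledRoot (charFun μ) m := by
  obtain ⟨ρ, hρ, h⟩ := hμ.exists_charFun_eq_rpow hm
  refine ⟨ρ.map (fun x => √m * x), Measure.isProbabilityMeasure_map (by fun_prop),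
    funext fun t => ?_⟩
  rw [charFun_map_mul, h, hμ.rescaledRoot_charFun hsymm, ← hμ.exp_neg_negLogNormCharFun,
    ← Real.exp_mul, neg_mul, div_eq_mul_inv]

lemma IsInfinitelyDivisible.sqrt_negLogNormCharFun_add_le (hμ : IsInfinitelyDivisible μ)
    (s t : ℝ) :
    √(negLogNormCharFun μ (s + t)) ≤ √(negLogNormCharFun μ s) + √(negLogNormCharFun μ t) :=
  have := hμ.1
  sqrt_add_le_of_forall_pos (negLogNormCharFun_nonneg μ s) (negLogNormCharFun_nonneg μ t)
    fun _ hl => hμ.negLogNormCharFun_add_le s t hl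

lemma IsInfinitelyDivisible.negLogNormCharFun_zero (hμ : IsInfinitelyDivisible μ) :
    negLogNormCharFun μ 0 = 0 := by
  have := hμ.1
  simp [negLogNormCharFun]

lemma IsInfinitelyDivisible.negLogNormCharFun_nat_mul_le (hμ : IsInfinitelyDivisible μ)
    (n : ℕ) (t : ℝ) : negLogNormCharFun μ (n * t) ≤ n ^ 2 * negLogNormCharFun μ t := by
  have := hμ.1
  have h := le_nat_mul_of_subadditive (p := fun t => √(negLogNormCharFun μ t))
    (by simp [hμ.negLogNormCharFun_zero]) hμ.sqrt_negLogNormCharFun_add_le n t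
  have h2 := pow_le_pow_left₀ (Real.sqrt_nonneg _) h 2
  rwa [mul_pow, Real.sq_sqrt (negLogNormCharFun_nonneg μ _),
    Real.sq_sqrt (negLogNormCharFun_nonneg μ _)] at h2

/-- The exponent `ψ` of a symmetric infinitely divisible law has a Gaussian part `c * t ^ 2`:
it is the limit of `ψ (√m t) / m` and a lower bound of `ψ`. -/
lemma IsInfinitelyDivisible.exists_gaussian_part (hμ : IsInfinitelyDivisible μ) :
    ∃ c : ℝ, 0 ≤ c ∧ (∀ t, c * t ^ 2 ≤ negLogNormCharFun μ t) ∧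
      ∀ t, Tendsto (fun m : ℕ => negLogNormCharFun μ (√m * t) / m) atTop (𝓝 (c * t ^ 2)) := by
  have := hμ.1
  obtain ⟨l, hl, hlim, hle⟩ := exists_tendsto_div_of_subadditive
    (p := fun t => √(negLogNormCharFun μ t)) hμ.continuous_negLogNormCharFun.sqrt
    (fun _ => Real.sqrt_nonneg _) (by simp [hμ.negLogNormCharFun_zero])
    hμ.sqrt_negLogNormCharFun_add_le
  have habs : ∀ t, negLogNormCharFun μ |t| = negLogNormCharFun μ t := fun t => by
    rcases abs_choice t with h | h <;> rw [h]
    exact negLogNormCharFun_neg μ t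
  refine ⟨l ^ 2, sq_nonneg l, fun t => ?_, fun t => ?_⟩
  · rcases eq_or_ne t 0 with rfl | ht
    · simp [hμ.negLogNormCharFun_zero]
    have h := pow_le_pow_left₀ (by positivity) (hle |t| (abs_pos.2 ht)) 2
    rwa [mul_pow, Real.sq_sqrt (negLogNormCharFun_nonneg μ _), habs, sq_abs] at h
  · rcases eq_or_ne t 0 with rfl | ht
    · simp [hμ.negLogNormCharFun_zero]
    have ht' := abs_pos.2 ht
    have h1 : Tendsto (fun m : ℕ => √(m : ℝ) * |t|) atTop atTop :=
      (Real.tendsto_sqrt_atTop.comp tendsto_natCast_atTop_atTop).atTop_mul_const ht'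
    -- Fekete's limit, squared, along `s = √m |t|`.
    have h2 := ((hlim.comp h1).pow 2).mul_const (t ^ 2)
    refine h2.congr fun m => ?_
    simp only [Function.comp]
    rw [div_pow, Real.sq_sqrt (negLogNormCharFun_nonneg μ _), mul_pow,
      Real.sq_sqrt (Nat.cast_nonneg m), sq_abs, ← habs (√m * t), abs_mul,
      abs_of_nonneg (Real.sqrt_nonneg _)]
    field_simp

end RescaledRoot

theorem corollary2 {Ω : Type*} [MeasurableSpace Ω] (P : Measure Ω) [IsProbabilityMeasure P]
    (X : Ω → ℝ) (hX : AEMeasurable X P)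
    (hsymm : ∀ t : ℝ, charFun (P.map X) (-t) = charFun (P.map X) t)
    (hdiv : IsInfinitelyDivisible (P.map X)) :
    -- every `f_m` is a characteristic function, and `Var X_m = Var X` in `[0, ∞]`
    (∀ m : ℕ, 1 ≤ m →
      (∃ μ : Measure ℝ, IsProbabilityMeasure μ ∧
        charFun μ = rescaledRoot (charFun (P.map X)) m) ∧
      ∀ (Ω' : Type*) [MeasurableSpace Ω'] (P' : Measure Ω') [IsProbabilityMeasure P']
        (Y : Ω' → ℝ), AEMeasurable Y P' →
        charFun (P'.map Y) = rescaledRoot (charFun (P.map X)) m →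
        evariance Y P' = evariance X P) ∧
    -- the limit `g` exists and is a characteristic function; if `X` is not Gaussian, then
    -- `Var X` is strictly greater than the variance of the law with characteristic function `g`
    ∃ g : ℝ → ℂ,
      (∀ t : ℝ, Tendsto (fun m : ℕ => rescaledRoot (charFun (P.map X)) m t) atTop (𝓝 (g t))) ∧
      (∃ μ : Measure ℝ, IsProbabilityMeasure μ ∧ charFun μ = g) ∧
      (¬ HasGaussianLaw X P →
        ∀ (Ω' : Type*) [MeasurableSpace Ω'] (P' : Measure Ω') [IsProbabilityMeasure P']
          (Z : Ω' → ℝ), AEMeasurable Z P' → charFun (P'.map Z) = g →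
          evariance Z P' < evariance X P) := by
  have hprob : IsProbabilityMeasure (P.map X) := hdiv.1
  set ψ := negLogNormCharFun (P.map X)
  have hf : ∀ t, charFun (P.map X) t = ((Real.exp (-ψ t) : ℝ) : ℂ) := fun t => by
    rw [hdiv.charFun_eq_norm hsymm, ← hdiv.exp_neg_negLogNormCharFun]
  have hψn := hdiv.negLogNormCharFun_nat_mul_le
  refine ⟨fun m hm => ⟨hdiv.exists_charFun_eq_rescaledRoot hsymm hm, ?_⟩, ?_⟩
  · intro Ω' _ P' _ Y hY hchar
    have hm0 : (0 : ℝ) < m := by exact_mod_cast hm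
    refine ENNReal.eq_of_forall_le_ofReal_two_mul_iff fun c hc => ?_
    rw [evariance_le_iff_exponent_le hX hf hψn hc,
      evariance_le_iff_exponent_le (ψ := fun t => ψ (√m * t) / m) hY
        (fun t => by rw [hchar, hdiv.rescaledRoot_charFun hsymm]) (fun n t => ?_) hc]
    -- Quadratic bounds are invariant under `t ↦ √m t` with division by `m`.
    · refine ⟨fun h t => ?_, fun h t => ?_⟩
      · have := h (t / √m)
        rwa [mul_div_cancel₀ t (Real.sqrt_pos.2 hm0).ne', div_pow, Real.sq_sqrt hm0.le,
          ← mul_div_assoc, div_le_div_iff_of_pos_right hm0] at this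
      · have := h (√m * t)
        rw [mul_pow, Real.sq_sqrt hm0.le] at this
        rw [div_le_iff₀ hm0]
        linarith
    · rw [← mul_div_assoc, div_le_div_iff_of_pos_right hm0, mul_left_comm]
      exact hψn n _
  · obtain ⟨c, hc, hle, hlim⟩ := hdiv.exists_gaussian_part
    have hgauss : ∀ t, charFun (gaussianReal 0 (2 * c).toNNReal) t
        = ((Real.exp (-(c * t ^ 2)) : ℝ) : ℂ) := fun t => by
      rw [charFun_gaussianReal, Real.coe_toNNReal _ (by positivity)]
      push_cast
      congr 1
      ring
    refine ⟨fun t => ((Real.exp (-(c * t ^ 2)) : ℝ) : ℂ), fun t => ?_,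
      ⟨gaussianReal 0 (2 * c).toNNReal, inferInstance, funext hgauss⟩, ?_⟩
    · simp only [hdiv.rescaledRoot_charFun hsymm]
      exact (Complex.continuous_ofReal.tendsto _).comp
        ((Real.continuous_exp.tendsto _).comp (hlim t).neg)
    · intro hng Ω' _ P' _ Z hZ hchar
      have hZle : evariance Z P' ≤ ENNReal.ofReal (2 * c) :=
        (evariance_le_iff_exponent_le (ψ := fun t => c * t ^ 2) hZ (fun t => by rw [hchar])
          (fun n t => le_of_eq (by ring)) hc).2 fun t => le_rfl
      -- Were `Var X ≤ 2c`, then `ψ(t) ≤ c t²`, hence equality.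
      refine hZle.trans_lt (not_le.1 fun hXle => hng ⟨?_⟩)
      have hψc := (evariance_le_iff_exponent_le hX hf hψn hc).1 hXle
      have : P.map X = gaussianReal 0 (2 * c).toNNReal := by
        refine Measure.ext_of_charFun (funext fun t => ?_)
        rw [hf, hgauss, le_antisymm (hψc t) (hle t)]
      rw [this]
      infer_instance
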